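/- \textbf{Setting.} Let $\mathcal S_0,\mathcal S_1,\mathcal S_2,\dots$ be measurable spaces, $\mathcal S_{1:0}=\{\varnothing\}$, $\mathcal S_{1:t}=\mathcal S_{1:t-1}\times\mathcal S_t$. Fix a prompt $s_0\in\mathcal S_0$ and a horizon $T\ge 2$. Let $\pi_{\rm ref}(\cdot\mid s_0,s_{1:t})$ be Markov kernels from $\mathcal S_{1:t}$ to $\mathcal S_{t+1}$ (the base model; for $t\ge T$ they play no role), and let $\hat V(s_0,\cdot):\mathcal S_{1:t}\to(0,\infty)$, $0\le t\le T$, be measurable (the reward model; write $\hat V(s_0)$ for its value at $\varnothing$). Write $Z_t(s_{1:t})=\mathbb E_{s_{t+1}\sim\pi_{\rm ref}(\cdot\mid s_0,s_{1:t})}[\hat V(s_0,s_{1:t+1})]$, and let $\tilde\pi_T(ds_{1:T})\propto\pi_{\rm ref}(ds_{1:T}\mid s_0)\,\hat V(s_0,s_{1:T})$ be the target distribution. Assume that for some $L>0$ and $\varepsilon\ge 0$: (A1) for all $1\le t\le T$ and all $s_{1:t}$, $\max\Big\{\frac{\hat V(s_0,s_{1:t-1})}{\hat V(s_0,s_{1:t})},\frac{\hat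 V(s_0,s_{1:t})}{\hat V(s_0,s_{1:t-1})}\Big\}\le L$; (A2) for all $1\le t\le T-1$ and all $s_{1:t}$, $\max\Big\{\frac{\hat V(s_0,s_{1:t})}{Z_t(s_{1:t})},\frac{Z_t(s_{1:t})}{\hat V(s_0,s_{1:t})}\Big\}\le 1+\varepsilon$. \textbf{SMC with the optimal proposal.} Let $\pi_{\rm p}(ds_{t+1}\mid s_0,s_{1:t})\propto\pi_{\rm ref}(ds_{t+1}\mid s_0,s_{1:t})\,\hat V(s_0,s_{1:t+1})$ and, for $1\le t\le T$, let $G_t(s_{1:t})=Z_{t-1}(s_{1:t-1})/\hat V(s_0,s_{1:t-1})$. Let $M_{t+1}$ be the kernel from $\mathcal S_{1:t}$ to $\mathcal S_{1:t+1}$ which keeps $s_{1:t}$ and appends $s_{t+1}\sim\pi_{\rm p}(\cdot\mid s_0,s_{1:t})$ for $t<T$, and let $M_{T+1}=\mathrm{Id}$ on $\mathcal S_{1:T}$. For a probability measure $\mu$ put $\Phi_{t+1}(\mu)(f)=\mu(G_t\,M_{t+1}f)/\mu(G_t)$. The Feynman--Kac flow is $\eta_1=\pi_{\rm p}(\cdot\mid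 s_0)$, $\eta_{t+1}=\Phi_{t+1}(\eta_t)$ for $1\le t\le T$. The particle system with $N\ge1$ particles starts from $X_1^1,\dots,X_1^N$ i.i.d. with law $\eta_1$; given the particles up to time $t$, with empirical measure $\eta_t^N=\frac1N\sum_i\delta_{X_t^i}$, the particles $X_{t+1}^1,\dots,X_{t+1}^N$ are i.i.d. with law $\Phi_{t+1}(\eta_t^N)$ (multinomial resampling with weights $G_t$, then propagation with $M_{t+1}$), for $1\le t\le T$. The output distribution is $\bar\eta_{T+1}^N=\mathbb E[\eta_{T+1}^N]$. Let $\|\mu-\nu\|_{\rm TV}=\sup_A|\mu(A)-\nu(A)|$. \textbf{Theorem.} Then $\eta_{T+1}=\tilde\pi_T$. For every $\delta_{\rm TV}\in(0,1)$ and every integer $N\ge1$ with $$N\ \ge\ \frac{\big((1+\varepsilon)^4-1\big)\,T^2\,(1+\varepsilon)^{6T}}{2\,\delta_{\rm TV}}$$ one has $\|\bar\eta_{T+1}^N-\eta_{T+1}\|_{\rm TV}\le\delta_{\rm TV}$. This sufficient number of particles does not depend on $L$. If $\varepsilon=0$, then $\bar\eta_{T+1}^N=\eta_{T+1}$ for every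 $N\ge1$; in particular a single particle samples exactly. -/

import Mathlib

open MeasureTheory ProbabilityTheory

open scoped ENNReal

namespace SMC

universe u

/-! ### Prefix spaces -/

/-- The space of prefixes `s_{1:t}`, with `S_{1:0} = {∅}` and `S_{1:t+1} = S_{1:t} × S_{t+1}`.
(`S 0` is the prompt space and does not enter.) -/
def Prefix (S : ℕ → Type u) : ℕ → Type u
  | 0 => PUnit
  | t + 1 => Prefix S t × S (t + 1)

instance Prefix.instMeasurableSpace (S : ℕ → Type u) [∀ t, MeasurableSpace (S t)] :
    ∀ t, MeasurableSpace (Prefix S t)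
  | 0 => inferInstanceAs (MeasurableSpace PUnit)
  | t + 1 =>
    letI := Prefix.instMeasurableSpace S t
    inferInstanceAs (MeasurableSpace (Prefix S t × S (t + 1)))

/-- The empty prefix. -/
def Prefix.nil (S : ℕ → Type u) : Prefix S 0 := PUnit.unit

/-- Appending one reasoning step to a prefix. -/
def Prefix.snoc {S : ℕ → Type u} {t : ℕ} (x : Prefix S t) (s : S (t + 1)) : Prefix S (t + 1) :=
  (x, s)

/-- The prefix with its last reasoning step removed. -/
def Prefix.init {S : ℕ → Type u} {t : ℕ} (x : Prefix S (t + 1)) : Prefix S t :=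
  Prod.fst x

noncomputable section

/-! ### Reweighting, Feynman-Kac steps and particles, on arbitrary spaces -/

section General

variable {E F : Type*} [MeasurableSpace E] [MeasurableSpace F]

/-- The normalized reweighting of `μ` by the weight `g`, i.e. `g μ / μ(g)`. -/
def reweight (μ : Measure E) (g : E → ℝ) : Measure E :=
  (∫⁻ x, ENNReal.ofReal (g x) ∂μ)⁻¹ • μ.withDensity (fun x => ENNReal.ofReal (g x))

/-- One step of the normalized Feynman-Kac flow, with potential `G` on `E` and Markov kernel `M`
from `E` to `F`: the measure `f ↦ μ(G · M f) / μ(G)`. -/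
def fkStep (G : E → ℝ) (M : Kernel E F) (μ : Measure E) : Measure F :=
  (reweight μ G).bind M

/-- The empirical measure of `N` particles. -/
def empirical {N : ℕ} (x : Fin N → E) : Measure E :=
  (N : ℝ≥0∞)⁻¹ • ∑ i, Measure.dirac (x i)

/-- One step of the particle system: conditionally on the current particles `x`, the new particles
are drawn independently from the Feynman-Kac update of the empirical measure of `x`. That update is
`∑ j, w̄ j • M (x j)` with `w̄ j = G (x j) / ∑ l, G (x l)`, so this is multinomial
resampling followed by independent propagation. -/
def particleStep {N : ℕ} (G : E → ℝ) (M : Kernel E F) (x : Fin N → E) : Measure (Fin N → F) :=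
  Measure.pi (fun _ => fkStep G M (empirical x))

/-- Total variation distance `sup_A |μ(A) - ν(A)|` (of probability measures). -/
def tvDist (μ ν : Measure E) : ℝ :=
  ⨆ A : {A : Set E // MeasurableSet A}, |μ.real A.1 - ν.real A.1|

end General

/-! ### The reasoning model, for a fixed prompt

`ref t` is the base model `π_ref(s_{t+1} | s_0, s_{1:t})` and `V t` is the reward model
`V̂(s_0, s_{1:t})`. -/

section Model

variable {S : ℕ → Type u} [∀ t, MeasurableSpace (S t)]
  (ref : ∀ t, Kernel (Prefix S t) (S (t + 1))) (V : ∀ t, Prefix S t → ℝ)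

/-- `E_{s_{t+1} ∼ π_ref(· | s_{1:t})} [V̂(s_{1:t+1})]`. -/
def expectedNext (t : ℕ) (x : Prefix S t) : ℝ :=
  ∫ s, V (t + 1) (x.snoc s) ∂(ref t x)

/-- Reward model ratio bound: consecutive rewards differ at most by the factor `L`. -/
def RewardRatioBound (T : ℕ) (L : ℝ) : Prop :=
  ∀ t < T, ∀ (x : Prefix S t) (s : S (t + 1)),
    V t x / V (t + 1) (x.snoc s) ≤ L ∧ V (t + 1) (x.snoc s) / V t x ≤ L

/-- Uniform bound on the one-step Bellman error, at the times `1 ≤ t < T` which have a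
next step and are not the bare prompt. -/
def BellmanErrorBound (T : ℕ) (ε : ℝ) : Prop :=
  ∀ t, 1 ≤ t → t < T → ∀ x : Prefix S t,
    V t x / expectedNext ref V t x ≤ 1 + ε ∧ expectedNext ref V t x / V t x ≤ 1 + ε

/-- The law of `s_{1:t}` under the base model. -/
def refLaw : ∀ t, Measure (Prefix S t)
  | 0 => Measure.dirac (Prefix.nil S)
  | t + 1 => Measure.compProd (refLaw t) (ref t)

/-- The reward-tilted distribution `π̃_t ∝ π_ref(s_{1:t}) V̂(s_{1:t})`. -/
def target (t : ℕ) : Measure (Prefix S t) :=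
  reweight (refLaw ref t) (V t)

variable [∀ t, IsMarkovKernel (ref t)]

/-- The optimal proposal `π_p(s_{t+1} | s_{1:t}) ∝ π_ref(s_{t+1} | s_{1:t}) V̂(s_{1:t+1})`. -/
def optimalProposal (t : ℕ) : Kernel (Prefix S t) (S (t + 1)) :=
  (ref t).withDensity
    (fun x s => ENNReal.ofReal (V (t + 1) (x.snoc s) / expectedNext ref V t x))

/-- The Markov propagation from `S_{1:t}` to `S_{1:t+1}`: keep the prefix and append a step drawn
from the optimal proposal. -/
def optimalKernel (t : ℕ) : Kernel (Prefix S t) (Prefix S (t + 1)) :=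
  show Kernel (Prefix S t) (Prefix S t × S (t + 1)) from
    Kernel.id ×ₖ optimalProposal ref V t

/-- The incremental weight of the optimal proposal,
`G_t(s_{1:t}) = E_{s_t ∼ π_ref(· | s_{1:t-1})} [V̂(s_{1:t})] / V̂(s_{1:t-1})` for `t ≥ 1`.
At `t = 0` all particles sit at the empty prefix and there is no reweighting. -/
def optimalPotential : ∀ t, Prefix S t → ℝ
  | 0, _ => 1
  | t + 1, x => expectedNext ref V t x.init / V t x.init

/-- The Feynman-Kac flow `η_t` of the optimal proposal. It starts from the empty prefix at time `0`,
so that `η_1` is the optimal proposal for the first step. -/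
def flow : ∀ t, Measure (Prefix S t)
  | 0 => Measure.dirac (Prefix.nil S)
  | t + 1 => fkStep (optimalPotential ref V t) (optimalKernel ref V t) (flow t)

/-- The terminal distribution `η_{T+1}`: one further step from `η_T`, with potential `G_T` and
the identity kernel. -/
def terminalFlow (T : ℕ) : Measure (Prefix S T) :=
  fkStep (optimalPotential ref V T) Kernel.id (flow ref V T)

/-- The joint law of the `N` particles at time `t`. At time `1` they are i.i.d. with law `η_1`. -/
def particleLaw (N : ℕ) : ∀ t, Measure (Fin N → Prefix S t)
  | 0 => Measure.dirac (fun _ => Prefix.nil S)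
  | t + 1 => (particleLaw N t).bind
      (particleStep (optimalPotential ref V t) (optimalKernel ref V t))

/-- The joint law of the `N` particles at time `T + 1`, after the terminal resampling step. -/
def terminalParticleLaw (N T : ℕ) : Measure (Fin N → Prefix S T) :=
  (particleLaw ref V N T).bind (particleStep (optimalPotential ref V T) Kernel.id)

/-- The output distribution `E[η^N_{T+1}]` of the sampler, i.e. the law of a uniformly chosen particle
at time `T + 1`. -/
def smcOutput (N T : ℕ) : Measure (Prefix S T) :=
  (terminalParticleLaw ref V N T).bind empirical

end Model

end

end SMC

/-!
For a test pair `0 ≤ a ≤ b`, a Feynman-Kac step sends the ratio `μ(a) / μ(b)` to the ratio of the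
transformed pair `G · M a ≤ G · M b`, and multiplies the oscillation `r` of the denominator by that
of `G`. Replacing a measure by the empirical measure of `N` independent samples biases such a ratio
by at most `r (r - 1) / N` only: freezing the contribution of one sample to the denominator costs
`O(1 / N)`, and once it is frozen the centred numerator of that sample integrates to zero. The bias
at time `T + 1` is therefore a sum of `T + 1` such terms with `r = q ^ k`. For the optimal proposal
the Bellman error bound gives `q = (1 + ε) ^ 2`; the first potential is constant. Since the
potentials telescope against the proposal densities, the flow reweighted by its potential is the
base model tilted by the reward.
-/

namespace SMC

section General

variable {E F : Type*} [MeasurableSpace E] [MeasurableSpace F]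

theorem integral_bind {μ : Measure E} {κ : E → Measure F} (hκ : Measurable κ) {f : F → ℝ}
    (hf : Integrable f (μ.bind κ)) : ∫ y, f y ∂(μ.bind κ) = ∫ x, ∫ y, f y ∂(κ x) ∂μ := by
  obtain ⟨K, rfl⟩ : ∃ K : Kernel E F, ⇑K = κ := ⟨⟨κ, hκ⟩, rfl⟩
  rw [Measure.comp_eq_comp_const_apply] at hf ⊢
  rw [Kernel.integral_comp hf, Kernel.const_apply]

theorem integrable_integral_of_integrable_bind {μ : Measure E} {κ : E → Measure F}
    (hκ : Measurable κ) {f : F → ℝ} (hf : Integrable f (μ.bind κ)) :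
    Integrable (fun x => ∫ y, f y ∂(κ x)) μ := by
  obtain ⟨K, rfl⟩ : ∃ K : Kernel E F, ⇑K = κ := ⟨⟨κ, hκ⟩, rfl⟩
  rw [Measure.comp_eq_comp_const_apply] at hf
  exact hf.integral_comp

theorem measurable_pi_const {ι : Type*} [Fintype ι] {κ : E → Measure F} (hκ : Measurable κ)
    (hprob : ∀ x, IsProbabilityMeasure (κ x)) :
    Measurable fun x => Measure.pi fun _ : ι => κ x := by
  refine Measurable.measure_of_isPiSystem_of_isProbabilityMeasure generateFrom_pi.symm
    isPiSystem_pi ?_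
  rintro _ ⟨s, hs, rfl⟩
  simp only [Measure.pi_pi]
  exact Finset.measurable_prod _ fun i _ => (Measure.measurable_coe (hs i trivial)).comp hκ

theorem abs_measureReal_sub_le_tvDist {μ ν : Measure E} [IsProbabilityMeasure μ]
    [IsProbabilityMeasure ν] {A : Set E} (hA : MeasurableSet A) :
    |μ.real A - ν.real A| ≤ tvDist μ ν := by
  refine le_ciSup (f := fun A : {A : Set E // MeasurableSet A} => |μ.real A.1 - ν.real A.1|)
    ⟨1, ?_⟩ ⟨A, hA⟩
  rintro _ ⟨B, rfl⟩
  exact abs_sub_le_of_nonneg_of_le measureReal_nonneg measureReal_le_one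
    measureReal_nonneg measureReal_le_one

theorem eq_of_tvDist_le_zero {μ ν : Measure E} [IsProbabilityMeasure μ] [IsProbabilityMeasure ν]
    (h : tvDist μ ν ≤ 0) : μ = ν := by
  ext A hA
  exact (measureReal_eq_measureReal_iff).1
    (sub_eq_zero.1 (abs_nonpos_iff.1 ((abs_measureReal_sub_le_tvDist hA).trans h)))

/-! ### Reweighting -/

theorem isProbabilityMeasure_reweight_iff {μ : Measure E} {g : E → ℝ} :
    IsProbabilityMeasure (reweight μ g) ↔
      ∫⁻ x, ENNReal.ofReal (g x) ∂μ ≠ 0 ∧ ∫⁻ x, ENNReal.ofReal (g x) ∂μ ≠ ∞ := by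
  rw [isProbabilityMeasure_iff, reweight, Measure.smul_apply, withDensity_apply _ .univ,
    Measure.restrict_univ, smul_eq_mul]
  refine ⟨fun h => ⟨fun h0 => ?_, fun htop => ?_⟩, fun h => ENNReal.inv_mul_cancel h.1 h.2⟩
  · simp [h0] at h
  · simp [htop] at h

theorem isProbabilityMeasure_reweight {μ : Measure E} {g : E → ℝ} (hint : Integrable g μ)
    (hnonneg : 0 ≤ g) (hpos : 0 < ∫ x, g x ∂μ) : IsProbabilityMeasure (reweight μ g) := by
  rw [isProbabilityMeasure_reweight_iff,
    ← ofReal_integral_eq_lintegral_ofReal hint (.of_forall hnonneg)]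
  exact ⟨(ENNReal.ofReal_pos.2 hpos).ne', ENNReal.ofReal_ne_top⟩

theorem reweight_eq_reweight {μ ν : Measure E} {g h : E → ℝ} {c : ℝ≥0∞} (hc0 : c ≠ 0)
    (hc : c ≠ ∞) (heq : μ.withDensity (fun x => ENNReal.ofReal (g x)) =
      c • ν.withDensity (fun x => ENNReal.ofReal (h x))) : reweight μ g = reweight ν h := by
  have hmass := congrArg (fun ρ : Measure E => ρ Set.univ) heq
  simp only [withDensity_apply _ MeasurableSet.univ, Measure.restrict_univ, Measure.smul_apply,
    smul_eq_mul] at hmass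
  rw [reweight, reweight, heq, hmass, smul_smul, ENNReal.mul_inv (.inl hc0) (.inl hc),
    mul_right_comm, ENNReal.inv_mul_cancel hc0 hc, one_mul]

theorem integral_reweight (μ : Measure E) {g : E → ℝ} (hg : Measurable g) (hnonneg : 0 ≤ g)
    (f : E → ℝ) : ∫ x, f x ∂(reweight μ g) = (∫ x, g x * f x ∂μ) / ∫ x, g x ∂μ := by
  rw [reweight, integral_smul_measure, integral_withDensity_eq_integral_toReal_smul
    hg.ennreal_ofReal (.of_forall fun _ => ENNReal.ofReal_lt_top),
    integral_eq_lintegral_of_nonneg_ae (.of_forall hnonneg) hg.aestronglyMeasurable]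
  simp only [ENNReal.toReal_ofReal (hnonneg _), smul_eq_mul, ENNReal.toReal_inv]
  ring

theorem measurable_reweight {g : E → ℝ} (hg : Measurable g) :
    Measurable fun μ : Measure E => reweight μ g := by
  refine Measure.measurable_of_measurable_coe _ fun s hs => ?_
  simp only [reweight, Measure.smul_apply, smul_eq_mul, withDensity_apply _ hs,
    ← lintegral_indicator hs]
  exact (Measure.measurable_lintegral hg.ennreal_ofReal).inv.mul
    (Measure.measurable_lintegral (hg.ennreal_ofReal.indicator hs))

/-! ### Empirical measures -/

theorem measurable_empirical (N : ℕ) : Measurable (empirical : (Fin N → E) → Measure E) := by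
  refine Measure.measurable_of_measurable_coe _ fun s hs => ?_
  simp only [empirical, Measure.smul_apply, Measure.finsetSum_apply, smul_eq_mul]
  refine Measurable.const_mul (Finset.measurable_sum _ fun i _ => ?_) _
  exact (Measure.measurable_coe hs).comp (Measure.measurable_dirac.comp (measurable_pi_apply i))

instance {N : ℕ} [NeZero N] (x : Fin N → E) : IsProbabilityMeasure (empirical x) :=
  ⟨by simp [empirical, ENNReal.inv_mul_cancel, NeZero.ne N]⟩

theorem empirical_const {N : ℕ} [NeZero N] (y : E) :
    empirical (fun _ : Fin N => y) = Measure.dirac y := by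
  rw [empirical, Finset.sum_const, Finset.card_fin, ← Nat.cast_smul_eq_nsmul ℝ≥0∞, smul_smul,
    ENNReal.inv_mul_cancel (by simp [NeZero.ne N]) (by simp), one_smul]

theorem integral_empirical {N : ℕ} (x : Fin N → E) {f : E → ℝ} (hf : Measurable f) :
    ∫ y, f y ∂(empirical x) = (∑ i, f (x i)) / N := by
  rw [empirical, integral_smul_measure, integral_finsetSum_measure]
  · simp [integral_dirac' f _ hf.stronglyMeasurable, div_eq_inv_mul]
  · exact fun i _ => integrable_dirac' hf.stronglyMeasurable (by simp)

/-! ### Potentials -/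

/-- A potential whose selection pressure is bounded by `q`: a measurable function bounded away
from zero whose values differ at most by the factor `q`. -/
structure IsPotential (G : E → ℝ) (q : ℝ) : Prop where
  measurable : Measurable G
  exists_mem_Icc : ∃ m > 0, ∀ x, G x ∈ Set.Icc m (q * m)

namespace IsPotential

variable {G : E → ℝ} {q : ℝ}

theorem pos (hG : IsPotential G q) (x : E) : 0 < G x :=
  let ⟨_, hm, hmG⟩ := hG.exists_mem_Icc
  hm.trans_le (hmG x).1

theorem one_le [Nonempty E] (hG : IsPotential G q) : 1 ≤ q := by
  obtain ⟨m, hm, hmG⟩ := hG.exists_mem_Icc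
  obtain ⟨hlow, hup⟩ := hmG (Classical.arbitrary E)
  exact (le_mul_iff_one_le_left hm).1 (hlow.trans hup)

theorem integrable (hG : IsPotential G q) (μ : Measure E) [IsFiniteMeasure μ] : Integrable G μ :=
  let ⟨m, _, hmG⟩ := hG.exists_mem_Icc
  .of_mem_Icc m (q * m) hG.measurable.aemeasurable (.of_forall hmG)

theorem integral_pos (hG : IsPotential G q) (μ : Measure E) [IsProbabilityMeasure μ] :
    0 < ∫ x, G x ∂μ := by
  rw [integral_pos_iff_support_of_nonneg (fun x => (hG.pos x).le) (hG.integrable μ),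
    Function.support_eq_univ fun x => (hG.pos x).ne']
  simp

theorem mul_integral_kernel (hG : IsPotential G q) (M : Kernel E F) [IsMarkovKernel M]
    {b : F → ℝ} {r : ℝ} (hb : IsPotential b r) :
    IsPotential (fun x => G x * ∫ y, b y ∂(M x)) (q * r) := by
  refine ⟨hG.measurable.mul hb.measurable.stronglyMeasurable.integral_kernel.measurable, ?_⟩
  obtain ⟨g, hg, hgG⟩ := hG.exists_mem_Icc
  obtain ⟨m, hm, hmb⟩ := hb.exists_mem_Icc
  refine ⟨g * m, mul_pos hg hm, fun x => ?_⟩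
  have hMb : ∫ y, b y ∂(M x) ∈ Set.Icc m (r * m) :=
    (convex_Icc _ _).integral_mem isClosed_Icc (.of_forall hmb) (hb.integrable (M x))
  have hGx := hgG x
  rw [mul_mul_mul_comm]
  exact ⟨mul_le_mul hGx.1 hMb.1 hm.le (hg.le.trans hGx.1),
    mul_le_mul hGx.2 hMb.2 (hm.le.trans hMb.1) (hg.le.trans (hGx.1.trans hGx.2))⟩

theorem isProbabilityMeasure_reweight (hG : IsPotential G q) (μ : Measure E)
    [IsProbabilityMeasure μ] : IsProbabilityMeasure (reweight μ G) :=
  SMC.isProbabilityMeasure_reweight (hG.integrable μ) (fun x => (hG.pos x).le) (hG.integral_pos μ)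

theorem isProbabilityMeasure_fkStep (hG : IsPotential G q) (M : Kernel E F) [IsMarkovKernel M]
    (μ : Measure E) [IsProbabilityMeasure μ] : IsProbabilityMeasure (fkStep G M μ) :=
  have := hG.isProbabilityMeasure_reweight μ
  isProbabilityMeasure_bind M.aemeasurable (.of_forall inferInstance)

theorem integral_fkStep (hG : IsPotential G q) (M : Kernel E F) (μ : Measure E) {f : F → ℝ}
    (hf : Integrable f (fkStep G M μ)) :
    ∫ y, f y ∂(fkStep G M μ) = (∫ x, G x * ∫ y, f y ∂(M x) ∂μ) / ∫ x, G x ∂μ := by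
  rw [fkStep, integral_bind M.measurable hf,
    integral_reweight μ hG.measurable fun x => (hG.pos x).le]

variable {N : ℕ} [NeZero N]

theorem isProbabilityMeasure_particleStep (hG : IsPotential G q) (M : Kernel E F)
    [IsMarkovKernel M] (x : Fin N → E) : IsProbabilityMeasure (particleStep G M x) :=
  have := hG.isProbabilityMeasure_fkStep M (empirical x)
  inferInstanceAs (IsProbabilityMeasure (Measure.pi fun _ => fkStep G M (empirical x)))

theorem measurable_particleStep (hG : IsPotential G q) (M : Kernel E F) [IsMarkovKernel M] :
    Measurable (particleStep (N := N) G M) :=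
  measurable_pi_const ((Measure.measurable_bind' M.measurable).comp
      ((measurable_reweight hG.measurable).comp (measurable_empirical N)))
    fun x => hG.isProbabilityMeasure_fkStep M (empirical x)

theorem isProbabilityMeasure_bind_particleStep (hG : IsPotential G q) (M : Kernel E F)
    [IsMarkovKernel M] (law : Measure (Fin N → E)) [IsProbabilityMeasure law] :
    IsProbabilityMeasure (law.bind (particleStep G M)) :=
  isProbabilityMeasure_bind (hG.measurable_particleStep M).aemeasurable
    (.of_forall (hG.isProbabilityMeasure_particleStep M))

end IsPotential

/-! ### Ratios of means -/

/-- The ratio of means `μ(a) / μ(b)`. Feynman-Kac steps act on such ratios by transforming `a` and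
`b`, which is why the approximation error of the particle system is measured with them. -/
noncomputable def meanRatio (μ : Measure E) (a b : E → ℝ) : ℝ :=
  (∫ x, a x ∂μ) / ∫ x, b x ∂μ

/-- The test functions for ratios of means: measurable functions `0 ≤ a ≤ b` whose denominator
`b` varies at most by the factor `r`. -/
structure IsTestPair (a b : E → ℝ) (r : ℝ) : Prop where
  measurable_left : Measurable a
  nonneg : 0 ≤ a
  le : a ≤ b
  isPotential_right : IsPotential b r

theorem isTestPair_indicator_one {A : Set E} (hA : MeasurableSet A) :
    IsTestPair (A.indicator 1) 1 1 where
  measurable_left := measurable_one.indicator hA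
  nonneg := Set.indicator_nonneg (by simp)
  le := Set.indicator_le_self' (by simp)
  isPotential_right := ⟨measurable_one, 1, one_pos, by simp⟩

namespace IsTestPair

variable {a b : E → ℝ} {r : ℝ}

theorem integrable_right (h : IsTestPair a b r) (μ : Measure E) [IsFiniteMeasure μ] :
    Integrable b μ :=
  h.isPotential_right.integrable μ

theorem integrable_left (h : IsTestPair a b r) (μ : Measure E) [IsFiniteMeasure μ] :
    Integrable a μ :=
  (h.integrable_right μ).mono' h.measurable_left.aestronglyMeasurable
    (.of_forall fun x => (Real.norm_of_nonneg (h.nonneg x)).trans_le (h.le x))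

theorem integral_right_pos (h : IsTestPair a b r) (μ : Measure E) [IsProbabilityMeasure μ] :
    0 < ∫ x, b x ∂μ :=
  h.isPotential_right.integral_pos μ

theorem meanRatio_mem_Icc (h : IsTestPair a b r) (μ : Measure E) [IsProbabilityMeasure μ] :
    meanRatio μ a b ∈ Set.Icc 0 1 :=
  have hb := (h.integral_right_pos μ).le
  ⟨div_nonneg (integral_nonneg h.nonneg) hb,
    div_le_one_of_le₀ (integral_mono (h.integrable_left μ) (h.integrable_right μ) h.le) hb⟩

theorem abs_sub_mul_le (h : IsTestPair a b r) {θ : ℝ} (hθ : θ ∈ Set.Icc 0 1) (x : E) :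
    |a x - θ * b x| ≤ b x := by
  have ha := h.nonneg x
  have hab := h.le x
  have hb := (h.isPotential_right.pos x).le
  rw [Pi.zero_apply] at ha
  exact abs_sub_le_of_nonneg_of_le ha hab (mul_nonneg hθ.1 hb) (mul_le_of_le_one_left hb hθ.2)

theorem integral_sub_meanRatio_mul (h : IsTestPair a b r) (μ : Measure E)
    [IsProbabilityMeasure μ] : ∫ x, (a x - meanRatio μ a b * b x) ∂μ = 0 := by
  rw [integral_sub (h.integrable_left μ) ((h.integrable_right μ).const_mul _), integral_const_mul,
    meanRatio, div_mul_cancel₀ _ (h.integral_right_pos μ).ne', sub_self]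

theorem meanRatio_empirical {N : ℕ} [NeZero N] (h : IsTestPair a b r) (x : Fin N → E) :
    meanRatio (empirical x) a b = (∑ i, a (x i)) / ∑ i, b (x i) := by
  rw [meanRatio, integral_empirical x h.measurable_left,
    integral_empirical x h.isPotential_right.measurable,
    div_div_div_cancel_right₀ (NeZero.ne (N : ℝ))]

theorem measurable_meanRatio_empirical {N : ℕ} [NeZero N] (h : IsTestPair a b r) :
    Measurable fun x : Fin N → E => meanRatio (empirical x) a b := by
  have ha := h.measurable_left
  have hb := h.isPotential_right.measurable
  simp only [h.meanRatio_empirical]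
  fun_prop

theorem integrable_meanRatio_empirical {N : ℕ} [NeZero N] (h : IsTestPair a b r)
    (law : Measure (Fin N → E)) [IsFiniteMeasure law] :
    Integrable (fun x => meanRatio (empirical x) a b) law :=
  .of_mem_Icc 0 1 h.measurable_meanRatio_empirical.aemeasurable
    (.of_forall fun x => h.meanRatio_mem_Icc (empirical x))

variable {G : E → ℝ} {q : ℝ} (M : Kernel E F) [IsMarkovKernel M] {a b : F → ℝ}

theorem mul_integral_kernel (h : IsTestPair a b r) (hG : IsPotential G q) :
    IsTestPair (fun x => G x * ∫ y, a y ∂(M x)) (fun x => G x * ∫ y, b y ∂(M x)) (q * r) where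
  measurable_left :=
    hG.measurable.mul h.measurable_left.stronglyMeasurable.integral_kernel.measurable
  nonneg x := mul_nonneg (hG.pos x).le (integral_nonneg h.nonneg)
  le x := mul_le_mul_of_nonneg_left
    (integral_mono (h.integrable_left (M x)) (h.integrable_right (M x)) h.le) (hG.pos x).le
  isPotential_right := hG.mul_integral_kernel M h.isPotential_right

theorem meanRatio_fkStep (h : IsTestPair a b r) (hG : IsPotential G q) (μ : Measure E)
    [IsProbabilityMeasure μ] :
    meanRatio (fkStep G M μ) a b =
      meanRatio μ (fun x => G x * ∫ y, a y ∂(M x)) (fun x => G x * ∫ y, b y ∂(M x)) := by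
  have := hG.isProbabilityMeasure_fkStep M μ
  rw [meanRatio, hG.integral_fkStep M μ (h.integrable_left _),
    hG.integral_fkStep M μ (h.integrable_right _),
    div_div_div_cancel_right₀ (hG.integral_pos μ).ne', meanRatio]

end IsTestPair

/-! ### Bias of the ratio of empirical means of independent particles -/

theorem abs_inv_add_sub_inv_add_le {m r b c : ℝ} (hm : 0 < m) (hb : b ∈ Set.Icc m (r * m))
    (hc : 0 ≤ c) : |(b + c)⁻¹ - (m + c)⁻¹| ≤ (r - 1) * m / (m + c) ^ 2 := by
  have hmc : 0 < m + c := by positivity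
  have hbc : 0 < b + c := hmc.trans_le (by linarith [hb.1])
  rw [inv_sub_inv hbc.ne' hmc.ne', abs_div, abs_of_pos (mul_pos hbc hmc), abs_sub_comm,
    abs_of_nonneg (by linarith [hb.1]), sq]
  obtain ⟨hmb, hbr⟩ := hb
  gcongr <;> linarith

/-- Since `d` is centred, `(b + c)⁻¹` may be replaced by its variation around a constant. -/
theorem abs_integral_div_add_le {μ : Measure E} [IsProbabilityMeasure μ] {b d : E → ℝ} {m r c : ℝ}
    (hb : Measurable b) (hd : Integrable d μ) (hd0 : ∫ x, d x ∂μ = 0) (hdb : ∀ x, |d x| ≤ b x)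
    (hm : 0 < m) (hmb : ∀ x, b x ∈ Set.Icc m (r * m)) (hc : 0 ≤ c) :
    |∫ x, d x / (b x + c) ∂μ| ≤ r * (r - 1) * (m / (m + c)) ^ 2 := by
  have hbound : ∀ x, ‖d x * ((b x + c)⁻¹ - (m + c)⁻¹)‖ ≤ r * (r - 1) * (m / (m + c)) ^ 2 := by
    intro x
    rw [Real.norm_eq_abs, abs_mul]
    calc |d x| * |(b x + c)⁻¹ - (m + c)⁻¹|
        ≤ (r * m) * ((r - 1) * m / (m + c) ^ 2) := by
          have := (abs_nonneg _).trans ((hdb x).trans (hmb x).2)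
          gcongr
          · exact (hdb x).trans (hmb x).2
          · exact abs_inv_add_sub_inv_add_le hm (hmb x) hc
      _ = r * (r - 1) * (m / (m + c)) ^ 2 := by rw [div_pow]; ring
  have hint : Integrable (fun x => d x * ((b x + c)⁻¹ - (m + c)⁻¹)) μ :=
    .of_bound (hd.aestronglyMeasurable.mul (by fun_prop)) _ (.of_forall hbound)
  have hcentre : ∫ x, d x / (b x + c) ∂μ = ∫ x, d x * ((b x + c)⁻¹ - (m + c)⁻¹) ∂μ := by
    rw [← add_zero (∫ x, d x * _ ∂μ), ← zero_mul (m + c)⁻¹, ← hd0, ← integral_mul_const,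
      ← integral_add hint (hd.mul_const _)]
    exact integral_congr_ae (.of_forall fun x => by ring)
  rw [hcentre]
  simpa using norm_integral_le_of_norm_le_const (μ := μ) (.of_forall hbound)

theorem integral_pi_eq_integral_integral_succAbove {n : ℕ} (μ : Measure E) [SigmaFinite μ]
    (i : Fin (n + 1)) {f : E → (Fin n → E) → ℝ}
    (hf : Integrable (fun x : Fin (n + 1) → E => f (x i) fun j => x (i.succAbove j))
      (Measure.pi fun _ => μ)) :
    ∫ x : Fin (n + 1) → E, f (x i) (fun j => x (i.succAbove j)) ∂(Measure.pi fun _ => μ) =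
      ∫ y, ∫ s, f s y ∂μ ∂(Measure.pi fun _ => μ) := by
  have hsplit := measurePreserving_piFinSuccAbove (fun _ => μ) i
  have hemb := (MeasurableEquiv.piFinSuccAbove (fun _ => E) i).measurableEmbedding
  exact (hsplit.integral_comp hemb (Function.uncurry f)).trans
    (integral_prod_symm _ ((hsplit.integrable_comp_emb hemb).1 hf))

theorem IsPotential.integrable_div_sum {ι : Type*} [Fintype ι] {b d : E → ℝ} {r : ℝ}
    (hb : IsPotential b r) (hd : Measurable d) (hdb : ∀ x, |d x| ≤ b x) (i : ι)
    (law : Measure (ι → E)) [IsFiniteMeasure law] :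
    Integrable (fun x => d (x i) / ∑ j, b (x j)) law := by
  have hbm := hb.measurable
  refine .of_bound (C := 1) (Measurable.aestronglyMeasurable (by fun_prop))
    (.of_forall fun x => ?_)
  have hsum : b (x i) ≤ ∑ j, b (x j) :=
    Finset.single_le_sum (f := fun j => b (x j)) (fun j _ => (hb.pos _).le) (Finset.mem_univ i)
  have hsum0 : 0 ≤ ∑ j, b (x j) := (hb.pos _).le.trans hsum
  rw [norm_div, Real.norm_eq_abs, Real.norm_of_nonneg hsum0]
  exact div_le_one_of_le₀ ((hdb _).trans hsum) hsum0

theorem abs_integral_div_sum_le {n : ℕ} {μ : Measure E} [IsProbabilityMeasure μ] {b d : E → ℝ}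
    {r : ℝ} (hb : IsPotential b r) (hd : Measurable d) (hd0 : ∫ x, d x ∂μ = 0)
    (hdb : ∀ x, |d x| ≤ b x) (i : Fin (n + 1)) :
    |∫ x : Fin (n + 1) → E, d (x i) / ∑ j, b (x j) ∂(Measure.pi fun _ => μ)| ≤
      r * (r - 1) / (n + 1 : ℕ) ^ 2 := by
  have hint := hb.integrable_div_sum hd hdb i (Measure.pi fun _ => μ)
  simp only [Fin.sum_univ_succAbove _ i] at hint ⊢
  rw [integral_pi_eq_integral_integral_succAbove μ i (f := fun s y => d s / (b s + ∑ j, b (y j)))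
    hint, ← Real.norm_eq_abs]
  have hr : 1 ≤ r := have := μ.nonempty_of_neZero; hb.one_le
  obtain ⟨m, hm, hmb⟩ := hb.exists_mem_Icc
  refine (norm_integral_le_of_norm_le_const (.of_forall fun y => ?_)).trans_eq
    (by rw [probReal_univ, mul_one])
  have hsum : n * m ≤ ∑ j, b (y j) := by
    simpa using Finset.card_nsmul_le_sum Finset.univ (fun j => b (y j)) m fun j _ => (hmb _).1
  have hsum0 : 0 ≤ ∑ j, b (y j) := (by positivity : 0 ≤ n * m).trans hsum
  have hratio : m / (m + ∑ j, b (y j)) ≤ 1 / (n + 1 : ℕ) := by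
    rw [div_le_div_iff₀ (by positivity) (by positivity)]
    push_cast
    linarith
  have hdint : Integrable d μ := (hb.integrable μ).mono' hd.aestronglyMeasurable (.of_forall hdb)
  rw [← mul_one_div (r * (r - 1)), ← one_div_pow]
  exact (abs_integral_div_add_le hb.measurable hdint hd0 hdb hm hmb hsum0).trans
    (mul_le_mul_of_nonneg_left (pow_le_pow_left₀ (by positivity) hratio 2)
      (mul_nonneg (by linarith) (by linarith)))

theorem IsTestPair.abs_integral_meanRatio_empirical_sub_le {N : ℕ} [NeZero N] {a b : E → ℝ} {r : ℝ}
    (h : IsTestPair a b r) (μ : Measure E) [IsProbabilityMeasure μ] :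
    |∫ x : Fin N → E, meanRatio (empirical x) a b ∂(Measure.pi fun _ => μ) - meanRatio μ a b| ≤
      r * (r - 1) / N := by
  obtain ⟨n, rfl⟩ := Nat.exists_eq_succ_of_ne_zero (NeZero.ne N)
  set θ := meanRatio μ a b
  have hb := h.isPotential_right
  have hd : Measurable fun x => a x - θ * b x :=
    h.measurable_left.sub (hb.measurable.const_mul θ)
  have hpos : ∀ x : Fin (n + 1) → E, 0 < ∑ j, b (x j) := fun x =>
    Finset.sum_pos (fun j _ => hb.pos _) Finset.univ_nonempty
  have hdb : ∀ x, |a x - θ * b x| ≤ b x := h.abs_sub_mul_le (h.meanRatio_mem_Icc μ)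
  have hexpand : ∀ x : Fin (n + 1) → E, meanRatio (empirical x) a b - θ =
      ∑ i, (a (x i) - θ * b (x i)) / ∑ j, b (x j) := fun x => by
    rw [h.meanRatio_empirical, ← Finset.sum_div, Finset.sum_sub_distrib, ← Finset.mul_sum, sub_div,
      mul_div_cancel_right₀ _ (hpos x).ne']
  calc |∫ x : Fin (n + 1) → E, meanRatio (empirical x) a b ∂(Measure.pi fun _ => μ) - θ|
      = |∑ i, ∫ x : Fin (n + 1) → E, (a (x i) - θ * b (x i)) / ∑ j, b (x j)
          ∂(Measure.pi fun _ => μ)| := by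
        rw [← integral_finsetSum _ fun i _ => hb.integrable_div_sum hd hdb i _,
          ← integral_congr_ae (.of_forall hexpand),
          integral_sub (h.integrable_meanRatio_empirical _) (integrable_const θ), integral_const,
          probReal_univ, one_smul]
    _ ≤ ∑ i : Fin (n + 1), r * (r - 1) / (n + 1 : ℕ) ^ 2 :=
        (Finset.abs_sum_le_sum_abs _ _).trans (Finset.sum_le_sum fun i _ =>
          abs_integral_div_sum_le hb hd (h.integral_sub_meanRatio_mul μ) hdb i)
    _ = r * (r - 1) / (n + 1 : ℕ) := by
        rw [Finset.sum_const, Finset.card_fin, nsmul_eq_mul]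
        field_simp

/-! ### Propagation of the bias along Feynman-Kac steps -/

/-- The law of `N` particles approximates `η` in the sense that ratios of empirical means of test
pairs have bias at most `c r`, where `r` is the oscillation of the denominator. -/
def RatioBiasBound {N : ℕ} (law : Measure (Fin N → E)) (η : Measure E) (c : ℝ → ℝ) : Prop :=
  ∀ ⦃a b : E → ℝ⦄ ⦃r : ℝ⦄, IsTestPair a b r →
    |∫ x, meanRatio (empirical x) a b ∂law - meanRatio η a b| ≤ c r

theorem ratioBiasBound_dirac {N : ℕ} [NeZero N] (y : E) :
    RatioBiasBound (Measure.dirac fun _ : Fin N => y) (Measure.dirac y) 0 := by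
  intro a b r h
  rw [integral_dirac' _ _ h.measurable_meanRatio_empirical.stronglyMeasurable, empirical_const,
    sub_self, abs_zero, Pi.zero_apply]

namespace RatioBiasBound

variable {N : ℕ} [NeZero N] {law : Measure (Fin N → E)} [IsProbabilityMeasure law] {η : Measure E}
  [IsProbabilityMeasure η] {c : ℝ → ℝ}

/-- Conditionally on the particles, one step adds the bias of `N` independent samples; by
`IsTestPair.meanRatio_fkStep` the rest is the previous bias for a transformed test pair. -/
theorem bind_particleStep (h : RatioBiasBound law η c) {G : E → ℝ} {q : ℝ} (hG : IsPotential G q)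
    (M : Kernel E F) [IsMarkovKernel M] :
    RatioBiasBound (law.bind (particleStep G M)) (fkStep G M η)
      (fun r => r * (r - 1) / N + c (q * r)) := by
  intro a b r hab
  have hab' := hab.mul_integral_kernel M hG
  set a' := fun x => G x * ∫ y, a y ∂(M x)
  set b' := fun x => G x * ∫ y, b y ∂(M x)
  have := hG.isProbabilityMeasure_bind_particleStep M law
  have hint := hab.integrable_meanRatio_empirical (law.bind (particleStep G M))
  have hstep : ∀ x : Fin N → E, ‖∫ y, meanRatio (empirical y) a b ∂(particleStep G M x)
      - meanRatio (empirical x) a' b'‖ ≤ r * (r - 1) / N := fun x => by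
    have := hG.isProbabilityMeasure_fkStep M (empirical x)
    rw [← hab.meanRatio_fkStep M hG]
    exact hab.abs_integral_meanRatio_empirical_sub_le (fkStep G M (empirical x))
  rw [integral_bind (hG.measurable_particleStep M) hint, hab.meanRatio_fkStep M hG η]
  refine (abs_sub_le _ (∫ x, meanRatio (empirical x) a' b' ∂law) _).trans (add_le_add ?_ (h hab'))
  rw [← integral_sub (integrable_integral_of_integrable_bind (hG.measurable_particleStep M) hint)
      (hab'.integrable_meanRatio_empirical law)]
  exact (norm_integral_le_of_norm_le_const (.of_forall hstep)).trans_eq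
    (by rw [probReal_univ, mul_one])

theorem tvDist_le (h : RatioBiasBound law η c) : tvDist (law.bind empirical) η ≤ c 1 := by
  have : Nonempty {A : Set E // MeasurableSet A} := ⟨⟨∅, .empty⟩⟩
  refine ciSup_le fun ⟨A, hA⟩ => ?_
  have : IsProbabilityMeasure (law.bind empirical) :=
    isProbabilityMeasure_bind (measurable_empirical N).aemeasurable (.of_forall inferInstance)
  have htest := isTestPair_indicator_one hA
  have hmean : ∀ (μ : Measure E) [IsProbabilityMeasure μ],
      meanRatio μ (A.indicator 1) 1 = ∫ x, A.indicator 1 x ∂μ := fun μ _ => by simp [meanRatio]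
  have hbind := integral_bind (measurable_empirical N) (htest.integrable_left (law.bind empirical))
  have hbias := h htest
  simp only [hmean] at hbias
  rwa [← integral_indicator_one hA, ← integral_indicator_one hA, hbind]

end RatioBiasBound

end General

/-! ### The optimal proposal -/

section Model

variable {S : ℕ → Type*} {V : ∀ t, Prefix S t → ℝ}

theorem RewardRatioBound.snoc_le {T : ℕ} {L : ℝ} (h : RewardRatioBound V T L) {t : ℕ} (ht : t < T)
    {x : Prefix S t} (hx : 0 < V t x) (s : S (t + 1)) : V (t + 1) (x.snoc s) ≤ L * V t x :=
  (div_le_iff₀ hx).1 (h t ht x s).2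

variable [∀ t, MeasurableSpace (S t)]

theorem Prefix.measurable_snoc (t : ℕ) :
    Measurable fun p : Prefix S t × S (t + 1) => Prefix.snoc p.1 p.2 :=
  measurable_id

theorem Prefix.measurable_init (t : ℕ) :
    Measurable (Prefix.init : Prefix S (t + 1) → Prefix S t) :=
  measurable_fst

theorem Prefix.measurable_snoc_left {t : ℕ} (x : Prefix S t) :
    Measurable (x.snoc : S (t + 1) → Prefix S (t + 1)) :=
  (Prefix.measurable_snoc t).comp measurable_prodMk_left

/-- The regularity of the reward model up to the horizon `T` under which the optimal proposal makes
sense: rewards are measurable and positive, and the expectations of the next reward exist. -/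
structure IsAdmissibleReward (ref : ∀ t, Kernel (Prefix S t) (S (t + 1)))
    (V : ∀ t, Prefix S t → ℝ) (T : ℕ) : Prop where
  measurable : ∀ t ≤ T, Measurable (V t)
  pos : ∀ t ≤ T, ∀ x, 0 < V t x
  integrable_snoc : ∀ t < T, ∀ x : Prefix S t, Integrable (fun s => V (t + 1) (x.snoc s)) (ref t x)

variable {ref : ∀ t, Kernel (Prefix S t) (S (t + 1))} [∀ t, IsMarkovKernel (ref t)]

instance isProbabilityMeasure_refLaw : ∀ t, IsProbabilityMeasure (refLaw ref t)
  | 0 => Measure.dirac.isProbabilityMeasure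
  | t + 1 =>
    have := isProbabilityMeasure_refLaw t
    inferInstanceAs (IsProbabilityMeasure (Measure.compProd (refLaw ref t) (ref t)))

theorem RewardRatioBound.isAdmissibleReward {T : ℕ} {L : ℝ} (h : RewardRatioBound V T L)
    (hmeas : ∀ t ≤ T, Measurable (V t)) (hpos : ∀ t ≤ T, ∀ x, 0 < V t x) :
    IsAdmissibleReward ref V T where
  measurable := hmeas
  pos := hpos
  integrable_snoc t ht x :=
    .of_mem_Icc 0 (L * V t x) ((hmeas (t + 1) ht).comp x.measurable_snoc_left).aemeasurable
      (.of_forall fun s => ⟨(hpos (t + 1) ht _).le, h.snoc_le ht (hpos t ht.le x) s⟩)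

theorem measurable_expectedNext {t : ℕ} (hV : Measurable (V (t + 1))) :
    Measurable (expectedNext ref V t) :=
  (hV.comp (Prefix.measurable_snoc t)).stronglyMeasurable.integral_kernel_prod_right'.measurable

theorem lintegral_optimalProposal {t : ℕ} (hV : Measurable (V (t + 1))) (x : Prefix S t)
    {f : S (t + 1) → ℝ≥0∞} (hf : Measurable f) :
    ∫⁻ s, f s ∂(optimalProposal ref V t x) =
      ∫⁻ s, ENNReal.ofReal (V (t + 1) (x.snoc s) / expectedNext ref V t x) * f s ∂(ref t x) :=
  Kernel.lintegral_withDensity _ ((hV.comp (Prefix.measurable_snoc t)).div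
    ((measurable_expectedNext hV).comp measurable_fst)).ennreal_ofReal x hf

namespace IsAdmissibleReward

variable {T t : ℕ}

theorem expectedNext_pos (h : IsAdmissibleReward ref V T) (ht : t < T) (x : Prefix S t) :
    0 < expectedNext ref V t x := by
  have hpos : ∀ s, 0 < V (t + 1) (x.snoc s) := fun s => h.pos (t + 1) ht _
  rw [expectedNext, integral_pos_iff_support_of_nonneg (fun s => (hpos s).le)
    (h.integrable_snoc t ht x), Function.support_eq_univ fun s => (hpos s).ne']
  simp

theorem isMarkovKernel_optimalProposal (h : IsAdmissibleReward ref V T) (ht : t < T) :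
    IsMarkovKernel (optimalProposal ref V t) := by
  refine ⟨fun x => ⟨?_⟩⟩
  have hZ := h.expectedNext_pos ht x
  rw [← lintegral_one, lintegral_optimalProposal (h.measurable (t + 1) ht) x measurable_const]
  simp only [mul_one]
  rw [← ofReal_integral_eq_lintegral_ofReal ((h.integrable_snoc t ht x).div_const _)
    (.of_forall fun s => div_nonneg (h.pos (t + 1) ht _).le hZ.le), integral_div, ← expectedNext,
    div_self hZ.ne', ENNReal.ofReal_one]

theorem isMarkovKernel_optimalKernel (h : IsAdmissibleReward ref V T) (ht : t < T) :
    IsMarkovKernel (optimalKernel ref V t) :=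
  have := h.isMarkovKernel_optimalProposal ht
  inferInstanceAs (IsMarkovKernel (Kernel.id ×ₖ optimalProposal ref V t))

theorem lintegral_optimalKernel (h : IsAdmissibleReward ref V T) (ht : t < T) (x : Prefix S t)
    {f : Prefix S (t + 1) → ℝ≥0∞} (hf : Measurable f) : ∫⁻ y, f y ∂(optimalKernel ref V t x) = ∫⁻ s,
      ENNReal.ofReal (V (t + 1) (x.snoc s) / expectedNext ref V t x) * f (x.snoc s) ∂(ref t x) := by
  have := h.isMarkovKernel_optimalProposal ht
  exact (Kernel.lintegral_id_prod hf (optimalProposal ref V t) x).trans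
    (lintegral_optimalProposal (h.measurable (t + 1) ht) x (hf.comp x.measurable_snoc_left))

theorem measurable_optimalPotential (h : IsAdmissibleReward ref V T) (ht : t ≤ T) :
    Measurable (optimalPotential ref V t) := by
  cases t with
  | zero => exact measurable_const
  | succ t =>
    exact ((measurable_expectedNext (h.measurable (t + 1) ht)).div
      (h.measurable t (Nat.le_of_succ_le ht))).comp (Prefix.measurable_init t)

theorem mul_lintegral_optimalKernel (h : IsAdmissibleReward ref V T) (ht : t < T) (x : Prefix S t)
    {f : Prefix S (t + 1) → ℝ≥0∞} (hf : Measurable f) :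
    ENNReal.ofReal (V t x) *
        ∫⁻ y, ENNReal.ofReal (optimalPotential ref V (t + 1) y) * f y ∂(optimalKernel ref V t x) =
      ∫⁻ s, ENNReal.ofReal (V (t + 1) (x.snoc s)) * f (x.snoc s) ∂(ref t x) := by
  have hZ := h.expectedNext_pos ht x
  have hVx := h.pos t ht.le x
  have hGf : Measurable fun y => ENNReal.ofReal (optimalPotential ref V (t + 1) y) * f y :=
    (h.measurable_optimalPotential ht).ennreal_ofReal.mul hf
  rw [h.lintegral_optimalKernel ht x hGf, ← lintegral_const_mul' _ _ ENNReal.ofReal_ne_top]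
  refine lintegral_congr fun s => ?_
  have hVs := h.pos (t + 1) ht (x.snoc s)
  have hG : optimalPotential ref V (t + 1) (x.snoc s) = expectedNext ref V t x / V t x := rfl
  rw [hG, ← mul_assoc, ← mul_assoc, ← ENNReal.ofReal_mul hVx.le,
    ← ENNReal.ofReal_mul (by positivity)]
  congr 2
  field_simp

theorem withDensity_optimalPotential_bind (h : IsAdmissibleReward ref V T) (ht : t < T) :
    (((refLaw ref t).withDensity fun x => ENNReal.ofReal (V t x)).bind
        (optimalKernel ref V t)).withDensity
      (fun y => ENNReal.ofReal (optimalPotential ref V (t + 1) y)) =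
    (refLaw ref (t + 1)).withDensity fun y => ENNReal.ofReal (V (t + 1) y) := by
  have hG := (h.measurable_optimalPotential (ref := ref) ht).ennreal_ofReal
  have hV := (h.measurable (t + 1) ht).ennreal_ofReal
  refine Measure.ext_of_lintegral _ fun f hf => ?_
  rw [lintegral_withDensity_eq_lintegral_mul _ hG hf,
    lintegral_withDensity_eq_lintegral_mul _ hV hf,
    Measure.lintegral_bind (Kernel.aemeasurable _) (hG.mul hf).aemeasurable,
    lintegral_withDensity_eq_lintegral_mul _ (h.measurable t ht.le).ennreal_ofReal
      (hG.mul hf).lintegral_kernel]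
  simp only [Pi.mul_apply, h.mul_lintegral_optimalKernel ht _ hf]
  exact (Measure.lintegral_compProd (μ := refLaw ref t) (κ := ref t) (hV.mul hf)).symm

theorem optimalPotential_mem_Icc (h : IsAdmissibleReward ref V T) {ε : ℝ}
    (hbellman : BellmanErrorBound ref V T ε)
    (ht : t + 2 ≤ T) (x : Prefix S (t + 2)) :
    optimalPotential ref V (t + 2) x ∈ Set.Icc (1 + ε)⁻¹ (1 + ε) := by
  obtain ⟨hinv, hle⟩ := hbellman (t + 1) (Nat.le_add_left _ _) ht x.init
  refine ⟨?_, hle⟩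
  rw [optimalPotential, ← inv_div]
  exact inv_anti₀ (div_pos (h.pos _ (Nat.le_of_succ_le ht) _) (h.expectedNext_pos ht _)) hinv

theorem isPotential_optimalPotential (h : IsAdmissibleReward ref V T) {ε : ℝ} (hε : 0 ≤ ε)
    (hbellman : BellmanErrorBound ref V T ε) (ht : t ≤ T) :
    IsPotential (optimalPotential ref V t) ((1 + ε) ^ 2) := by
  refine ⟨h.measurable_optimalPotential ht, ?_⟩
  have hq : 1 ≤ (1 + ε) ^ 2 := one_le_pow₀ (by linarith)
  match t, ht with
  | 0, _ => exact ⟨1, one_pos, fun x => ⟨le_rfl, by simpa [optimalPotential] using hq⟩⟩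
  | 1, ht =>
    have hc : 0 < expectedNext ref V 0 (Prefix.nil S) / V 0 (Prefix.nil S) :=
      div_pos (h.expectedNext_pos ht _) (h.pos 0 (Nat.zero_le _) _)
    exact ⟨_, hc, fun x => ⟨le_rfl, le_mul_of_one_le_left hc.le hq⟩⟩
  | t + 2, ht =>
    refine ⟨(1 + ε)⁻¹, by positivity, fun x => ?_⟩
    rw [sq, mul_assoc, mul_inv_cancel₀ (by positivity), mul_one]
    exact h.optimalPotential_mem_Icc hbellman ht x

/-! ### The Feynman-Kac flow and the particle system -/

variable {q : ℝ}

theorem isProbabilityMeasure_flow (h : IsAdmissibleReward ref V T)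
    (hG : ∀ t ≤ T, IsPotential (optimalPotential ref V t) q) :
    ∀ t ≤ T, IsProbabilityMeasure (flow ref V t)
  | 0, _ => Measure.dirac.isProbabilityMeasure
  | t + 1, ht =>
    have := h.isMarkovKernel_optimalKernel ht
    have := h.isProbabilityMeasure_flow hG t (Nat.le_of_succ_le ht)
    (hG t (Nat.le_of_succ_le ht)).isProbabilityMeasure_fkStep (optimalKernel ref V t) (flow ref V t)

theorem isProbabilityMeasure_terminalFlow (h : IsAdmissibleReward ref V T)
    (hG : ∀ t ≤ T, IsPotential (optimalPotential ref V t) q) :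
    IsProbabilityMeasure (terminalFlow ref V T) :=
  have := h.isProbabilityMeasure_flow hG T le_rfl
  (hG T le_rfl).isProbabilityMeasure_fkStep Kernel.id (flow ref V T)

theorem reweight_flow_eq_target (h : IsAdmissibleReward ref V T)
    (hG : ∀ t ≤ T, IsPotential (optimalPotential ref V t) q) :
    ∀ t ≤ T, reweight (flow ref V t) (optimalPotential ref V t) = target ref V t
  | 0, _ => by
    have hp := h.pos 0 (Nat.zero_le _) (Prefix.nil S)
    refine reweight_eq_reweight (c := (ENNReal.ofReal (V 0 (Prefix.nil S)))⁻¹) (by simp)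
      (by simpa using hp) ?_
    rw [flow, refLaw, dirac_withDensity' (h.measurable 0 (Nat.zero_le _)).ennreal_ofReal,
      dirac_withDensity' (h.measurable_optimalPotential (Nat.zero_le _)).ennreal_ofReal, smul_smul,
      ENNReal.inv_mul_cancel (by simpa using hp) ENNReal.ofReal_ne_top]
    simp [optimalPotential]
  | t + 1, ht => by
    have ht' := Nat.le_of_succ_le ht
    have htarget := h.reweight_flow_eq_target hG t ht'
    have := h.isProbabilityMeasure_flow hG t ht'
    have hmass : IsProbabilityMeasure (target ref V t) :=
      htarget ▸ (hG t ht').isProbabilityMeasure_reweight (flow ref V t)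
    obtain ⟨hmass0, hmass_top⟩ := isProbabilityMeasure_reweight_iff.1 hmass
    refine reweight_eq_reweight (ENNReal.inv_ne_zero.2 hmass_top) (ENNReal.inv_ne_top.2 hmass0) ?_
    rw [flow, fkStep, htarget, target, reweight, Measure.bind_smul, withDensity_smul_measure,
      h.withDensity_optimalPotential_bind ht]

theorem terminalFlow_eq_target (h : IsAdmissibleReward ref V T)
    (hG : ∀ t ≤ T, IsPotential (optimalPotential ref V t) q) :
    terminalFlow ref V T = target ref V T := by
  rw [terminalFlow, fkStep, h.reweight_flow_eq_target hG T le_rfl]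
  exact Measure.bind_dirac

variable {N : ℕ} [NeZero N]

theorem isProbabilityMeasure_particleLaw (h : IsAdmissibleReward ref V T)
    (hG : ∀ t ≤ T, IsPotential (optimalPotential ref V t) q) :
    ∀ t ≤ T, IsProbabilityMeasure (particleLaw ref V N t)
  | 0, _ => Measure.dirac.isProbabilityMeasure
  | t + 1, ht =>
    have := h.isMarkovKernel_optimalKernel ht
    have := h.isProbabilityMeasure_particleLaw hG t (Nat.le_of_succ_le ht)
    (hG t (Nat.le_of_succ_le ht)).isProbabilityMeasure_bind_particleStep (optimalKernel ref V t)
      (particleLaw ref V N t)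

theorem isProbabilityMeasure_terminalParticleLaw (h : IsAdmissibleReward ref V T)
    (hG : ∀ t ≤ T, IsPotential (optimalPotential ref V t) q) :
    IsProbabilityMeasure (terminalParticleLaw ref V N T) :=
  have := h.isProbabilityMeasure_particleLaw (N := N) hG T le_rfl
  (hG T le_rfl).isProbabilityMeasure_bind_particleStep Kernel.id (particleLaw ref V N T)

theorem isProbabilityMeasure_smcOutput (h : IsAdmissibleReward ref V T)
    (hG : ∀ t ≤ T, IsPotential (optimalPotential ref V t) q) :
    IsProbabilityMeasure (smcOutput ref V N T) :=
  have := h.isProbabilityMeasure_terminalParticleLaw (N := N) hG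
  isProbabilityMeasure_bind (measurable_empirical N).aemeasurable (.of_forall inferInstance)

theorem ratioBiasBound_particleLaw (h : IsAdmissibleReward ref V T)
    (hG : ∀ t ≤ T, IsPotential (optimalPotential ref V t) q) : ∀ t ≤ T,
    RatioBiasBound (particleLaw ref V N t) (flow ref V t)
      fun r => (∑ k ∈ Finset.range t, q ^ k * r * (q ^ k * r - 1)) / N
  | 0, _ => by
    simp only [Finset.range_zero, Finset.sum_empty, zero_div]
    exact ratioBiasBound_dirac (Prefix.nil S)
  | t + 1, ht => by
    have ht' := Nat.le_of_succ_le ht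
    have := h.isMarkovKernel_optimalKernel ht
    have := h.isProbabilityMeasure_flow hG t ht'
    have := h.isProbabilityMeasure_particleLaw (N := N) hG t ht'
    have hstep : RatioBiasBound (particleLaw ref V N (t + 1)) (flow ref V (t + 1)) _ :=
      (h.ratioBiasBound_particleLaw hG t ht').bind_particleStep (hG t ht') (optimalKernel ref V t)
    simpa only [Finset.sum_range_succ', pow_zero, one_mul, pow_succ, mul_assoc, add_div,
      add_comm] using hstep

theorem tvDist_smcOutput_terminalFlow_le (h : IsAdmissibleReward ref V T)
    (hG : ∀ t ≤ T, IsPotential (optimalPotential ref V t) q) :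
    tvDist (smcOutput ref V N T) (terminalFlow ref V T) ≤
      (∑ k ∈ Finset.range (T + 1), q ^ k * (q ^ k - 1)) / N := by
  have := h.isProbabilityMeasure_flow hG T le_rfl
  have := h.isProbabilityMeasure_particleLaw (N := N) hG T le_rfl
  have := h.isProbabilityMeasure_terminalFlow hG
  have := h.isProbabilityMeasure_terminalParticleLaw (N := N) hG
  have hstep : RatioBiasBound (terminalParticleLaw ref V N T) (terminalFlow ref V T) _ :=
    (h.ratioBiasBound_particleLaw (N := N) hG T le_rfl).bind_particleStep (hG T le_rfl) Kernel.id
  refine hstep.tvDist_le.trans_eq ?_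
  simp [Finset.sum_range_succ', pow_succ]

end IsAdmissibleReward

end Model

theorem sum_pow_mul_pow_sub_one_le {q : ℝ} (hq : 1 ≤ q) (T : ℕ) :
    ∑ k ∈ Finset.range (T + 1), q ^ k * (q ^ k - 1) ≤ T * (q ^ T * (q ^ T - 1)) := by
  rw [Finset.sum_range_succ', pow_zero, sub_self, mul_zero, add_zero, ← nsmul_eq_mul]
  refine Finset.sum_le_card_nsmul _ _ _ (fun k hk => ?_) |>.trans_eq (by rw [Finset.card_range])
  have hle : q ^ (k + 1) ≤ q ^ T := pow_le_pow_right₀ hq (Finset.mem_range.1 hk)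
  have hk1 : 1 ≤ q ^ (k + 1) := one_le_pow₀ hq
  exact mul_le_mul hle (sub_le_sub_right hle 1) (sub_nonneg.2 hk1) (by positivity)

theorem mul_pow_mul_pow_sub_one_le {q : ℝ} (hq : 1 ≤ q) (T : ℕ) :
    T * (q ^ T * (q ^ T - 1)) ≤ (q ^ 2 - 1) * (T : ℝ) ^ 2 * q ^ (3 * T) / 2 := by
  have hgeom : q ^ T - 1 ≤ (q - 1) * (T * q ^ T) := by
    rw [← mul_geom_sum]
    refine mul_le_mul_of_nonneg_left ?_ (sub_nonneg.2 hq)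
    calc ∑ i ∈ Finset.range T, q ^ i ≤ ∑ _i ∈ Finset.range T, q ^ T :=
          Finset.sum_le_sum fun i hi => pow_le_pow_right₀ hq (Finset.mem_range.1 hi).le
      _ = T * q ^ T := by simp
  have hfactor : 1 ≤ q ^ T * ((q + 1) / 2) :=
    one_le_mul_of_one_le_of_one_le (one_le_pow₀ hq) (by linarith)
  have : 0 ≤ q - 1 := sub_nonneg.2 hq
  calc T * (q ^ T * (q ^ T - 1)) ≤ T * (q ^ T * ((q - 1) * (T * q ^ T))) := by gcongr
    _ ≤ T * (q ^ T * ((q - 1) * (T * q ^ T))) * (q ^ T * ((q + 1) / 2)) :=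
        le_mul_of_one_le_right (by positivity) hfactor
    _ = (q ^ 2 - 1) * (T : ℝ) ^ 2 * q ^ (3 * T) / 2 := by ring

end SMC

theorem mainTheorem8_general {S : ℕ → Type*} [∀ t, MeasurableSpace (S t)]
    (ref : ∀ t, Kernel (SMC.Prefix S t) (S (t + 1))) [∀ t, IsMarkovKernel (ref t)]
    (V : ∀ t, SMC.Prefix S t → ℝ) (T : ℕ) (hV : SMC.IsAdmissibleReward ref V T)
    (ε : ℝ) (hε : 0 ≤ ε) (hbellman : SMC.BellmanErrorBound ref V T ε)
    (δ : ℝ) (hδ0 : 0 < δ) (N : ℕ) (hN : 1 ≤ N) :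
    SMC.terminalFlow ref V T = SMC.target ref V T ∧
    (((1 + ε) ^ 4 - 1) * (T : ℝ) ^ 2 * (1 + ε) ^ (6 * T) / (2 * δ) ≤ (N : ℝ) →
      SMC.tvDist (SMC.smcOutput ref V N T) (SMC.terminalFlow ref V T) ≤ δ) ∧
    (ε = 0 → SMC.smcOutput ref V N T = SMC.terminalFlow ref V T) := by
  have : NeZero N := ⟨Nat.one_le_iff_ne_zero.1 hN⟩
  have hN0 : (0 : ℝ) < N := Nat.cast_pos.2 hN
  have hG : ∀ t ≤ T, SMC.IsPotential (SMC.optimalPotential ref V t) ((1 + ε) ^ 2) :=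
    fun t ht => hV.isPotential_optimalPotential hε hbellman ht
  have htv := hV.tvDist_smcOutput_terminalFlow_le (N := N) hG
  refine ⟨hV.terminalFlow_eq_target hG, fun hle => htv.trans ?_, ?_⟩
  · have hq : 1 ≤ (1 + ε) ^ 2 := one_le_pow₀ (by linarith)
    have hsum := (SMC.sum_pow_mul_pow_sub_one_le hq T).trans
      (SMC.mul_pow_mul_pow_sub_one_le hq T)
    rw [← pow_mul, ← pow_mul, ← mul_assoc] at hsum
    rw [div_le_iff₀ (by positivity)] at hle
    rw [div_le_iff₀ hN0]
    linarith
  · rintro rfl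
    have := hV.isProbabilityMeasure_terminalFlow hG
    have := hV.isProbabilityMeasure_smcOutput (N := N) hG
    exact SMC.eq_of_tvDist_le_zero (htv.trans_eq (by simp))

theorem mainTheorem8 {S : ℕ → Type*} [∀ t, MeasurableSpace (S t)] (s₀ : S 0)
    (πref : S 0 → ∀ t, Kernel (SMC.Prefix S t) (S (t + 1)))
    [∀ s t, IsMarkovKernel (πref s t)]
    (V : S 0 → ∀ t, SMC.Prefix S t → ℝ)
    (T : ℕ) (hT : 2 ≤ T)
    (hVmeas : ∀ t ≤ T, Measurable (V s₀ t))
    (hVpos : ∀ t ≤ T, ∀ x, 0 < V s₀ t x)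
    (L : ℝ) (hL : 0 < L) (hratio : SMC.RewardRatioBound (V s₀) T L)
    (ε : ℝ) (hε : 0 ≤ ε) (hbellman : SMC.BellmanErrorBound (πref s₀) (V s₀) T ε)
    (δ : ℝ) (hδ0 : 0 < δ) (hδ1 : δ < 1)
    (N : ℕ) (hN : 1 ≤ N) :
    SMC.terminalFlow (πref s₀) (V s₀) T = SMC.target (πref s₀) (V s₀) T ∧
    (((1 + ε) ^ 4 - 1) * (T : ℝ) ^ 2 * (1 + ε) ^ (6 * T) / (2 * δ) ≤ (N : ℝ) →
      SMC.tvDist (SMC.smcOutput (πref s₀) (V s₀) N T) (SMC.terminalFlow (πref s₀) (V s₀) T) ≤ δ) ∧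
    (ε = 0 →
      SMC.smcOutput (πref s₀) (V s₀) N T = SMC.terminalFlow (πref s₀) (V s₀) T) :=
  mainTheorem8_general (πref s₀) (V s₀) T (hratio.isAdmissibleReward hVmeas hVpos) ε hε hbellman
    δ hδ0 N hN
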